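/- Let $K$ be a number field with algebraic closure $\overline{K}$, let $f(z)\in K[z]$ be a monic polynomial of degree $d$, and let $(P_n)_{n\ge 0}$ be a sequence in $\overline{K}$ with $f(P_{n+1})=P_n$ for all $n\ge 0$. Suppose that there is a prime $\mathfrak{p}$ of $K$, lying above a rational prime $p\nmid d$, such that (i) $f$ has good reduction at $\mathfrak{p}$, i.e. every coefficient $a$ of $f$ satisfies $|a|_{\mathfrak{p}}\le 1$; and (ii) $P_0$ is not in the $\mathfrak{p}$-adic filled Julia set of $f$, i.e. for some extension $|\cdot|$ of $|\cdot|_{\mathfrak{p}}$ to an absolute value on $\overline{K}$, the forward orbit $P_0, f(P_0), f(f(P_0)),\dots$ is unbounded with respect to $|\cdot|$. (If $P_0\in K$, this does not depend on the choice of the extension.) Then for all sufficiently large $n$ we have $K(P_n)\subseteq K(P_{n+1})$ and $[K(P_{n+1}):K(P_n)]=d$. -/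

import Mathlib

open Polynomial
open scoped NumberField IntermediateField

/-- The filled Julia set of the polynomial `g` with respect to the absolute value `w`: the set of
all `z` whose forward orbit under `g` is bounded. -/
def filledJuliaSet {L : Type*} [Field L] (w : AbsoluteValue L ℝ) (g : L[X]) : Set L :=
  {z | ∃ C : ℝ, ∀ N : ℕ, w ((fun x => g.eval x)^[N] z) ≤ C}

/-- Good reduction of a monic polynomial at a prime `v` of a number field: all coefficients have
`v`-adic absolute value at most one. -/
def MonicHasGoodReduction {K : Type*} [Field K] [NumberField K]
    (v : IsDedekindDomain.HeightOneSpectrum (𝓞 K)) (f : K[X]) : Prop :=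
  ∀ i : ℕ, NumberField.HeightOneSpectrum.adicAbv K v (f.coeff i) ≤ 1

/-!
Outside the closed unit disc the value of `f` has the size of its leading term, so
`|P n| ^ d ^ n = |P 0| > 1` for every `n`. Since `K` is discretely valued, an element that is so
close to the unit circle has large degree: two terms of its minimal polynomial have equal size,
whence some power `|P n| ^ k` with `0 < k ≤ [K(P n) : K]` lies in the value group of `K`, and so it
is at least a fixed `q > 1`. Hence `[K(P n) : K]` is at least a constant times `d ^ n`. On the other
hand it grows by a factor at most `d` at each step, and a smaller factor infinitely often would make
`[K(P n) : K] / d ^ n` tend to `0`.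
-/

section AbsoluteValue

variable {K L : Type*} [Field K] [Field L] [Algebra K L] {w : AbsoluteValue L ℝ}

theorem apply_algebraMap_of_liesOver {v : AbsoluteValue K ℝ} (hwv : w.LiesOver v) (c : K) :
    w (algebraMap K L c) = v c :=
  DFunLike.congr_fun hwv.comp_eq c

theorem isNonarchimedean_of_liesOver {v : AbsoluteValue K ℝ} (hv : IsNonarchimedean v)
    (hwv : w.LiesOver v) : IsNonarchimedean w := by
  have hnat (n : ℕ) : w n ≤ 1 := by
    rw [← map_natCast (algebraMap K L), apply_algebraMap_of_liesOver hwv]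
    exact hv.apply_natCast_le_one
  have : IsUltrametricDist (WithAbs w) :=
    IsUltrametricDist.isUltrametricDist_of_forall_norm_natCast_le_one hnat
  exact fun x y => IsUltrametricDist.isNonarchimedean_norm (WithAbs.toAbs w x) (WithAbs.toAbs w y)

theorem exists_ne_apply_eq_of_sum_eq_zero {R ι : Type*} [Ring R] {w : AbsoluteValue R ℝ}
    (hw : IsNonarchimedean w) {s : Finset ι} {l : ι → R} (hsum : ∑ i ∈ s, l i = 0)
    (hne : ∃ i ∈ s, l i ≠ 0) :
    ∃ i ∈ s, ∃ j ∈ s, i ≠ j ∧ l i ≠ 0 ∧ w (l i) = w (l j) := by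
  obtain ⟨a, ha, ha0⟩ := hne
  obtain ⟨k, hk, hmax⟩ := s.exists_max_image (fun i => w (l i)) ⟨a, ha⟩
  have hk0 : 0 < w (l k) := (w.pos ha0).trans_le (hmax a ha)
  by_contra! hdistinct
  have hdominant : w (∑ i ∈ s, l i) = w (l k) :=
    hw.apply_sum_eq_of_lt (fun a => (w.map_neg a).symm) hk fun j hj hjk =>
      (hmax j hj).lt_of_ne' (hdistinct k hk j hj hjk.symm (w.pos_iff.mp hk0))
  rw [hsum, map_zero] at hdominant
  exact hk0.ne hdominant

theorem exists_apply_pow_eq_apply_algebraMap (hw : IsNonarchimedean w) {x : L}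
    (hx : IsIntegral K x) (hx0 : x ≠ 0) :
    ∃ k, 0 < k ∧ k ≤ (minpoly K x).natDegree ∧ ∃ c : K, w x ^ k = w (algebraMap K L c) := by
  set g := minpoly K x
  have hsum : ∑ i ∈ Finset.range (g.natDegree + 1), algebraMap K L (g.coeff i) * x ^ i = 0 := by
    simp only [← Algebra.smul_def, ← aeval_eq_sum_range, g, minpoly.aeval]
  have hlead : algebraMap K L (g.coeff g.natDegree) * x ^ g.natDegree ≠ 0 := by
    simp [(minpoly.monic hx).coeff_natDegree, g, hx0]
  obtain ⟨i, hi, j, hj, hij, hi0, heq⟩ :=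
    exists_ne_apply_eq_of_sum_eq_zero hw hsum ⟨_, Finset.self_mem_range_succ _, hlead⟩
  have hj0 : algebraMap K L (g.coeff j) * x ^ j ≠ 0 := by
    rwa [← w.ne_zero_iff, ← heq, w.ne_zero_iff]
  rw [Finset.mem_range] at hi hj
  wlog hlt : i < j generalizing i j
  · exact this j hj i hi hij.symm hj0 heq.symm hi0 (by omega)
  refine ⟨j - i, by omega, by omega, g.coeff i / g.coeff j, ?_⟩
  have hcj : w (algebraMap K L (g.coeff j)) ≠ 0 := w.ne_zero (left_ne_zero_of_mul hj0)
  rw [map_mul, map_mul, map_pow, map_pow] at heq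
  rw [map_div₀, map_div₀, pow_sub₀ _ (w.ne_zero hx0) hlt.le, ← div_eq_mul_inv,
    div_eq_div_iff (pow_ne_zero i (w.ne_zero hx0)) hcj, heq, mul_comm]

theorem le_apply_pow_finrank_adjoin_simple (hw : IsNonarchimedean w) {q : ℝ}
    (hq : ∀ c : K, 1 < w (algebraMap K L c) → q ≤ w (algebraMap K L c)) {x : L}
    (hx : IsIntegral K x) (hx1 : 1 < w x) : q ≤ w x ^ Module.finrank K K⟮x⟯ := by
  have hx0 : x ≠ 0 := w.pos_iff.mp (zero_lt_one.trans hx1)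
  obtain ⟨k, hk0, hk, c, hc⟩ := exists_apply_pow_eq_apply_algebraMap hw hx hx0
  rw [IntermediateField.adjoin.finrank hx]
  calc q ≤ w (algebraMap K L c) := hq c (hc ▸ one_lt_pow₀ hx1 hk0.ne')
    _ = w x ^ k := hc.symm
    _ ≤ w x ^ (minpoly K x).natDegree := pow_le_pow_right₀ hx1.le hk

end AbsoluteValue

open scoped NNReal in
theorem le_adicAbv_of_one_lt {R K : Type*} [CommRing R] [IsDedekindDomain R] [Field K]
    [Algebra R K] [IsFractionRing R K] (v : IsDedekindDomain.HeightOneSpectrum R) {b : ℝ≥0}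
    (hb : 1 < b) {x : K} (hx : 1 < v.adicAbv hb x) : (b : ℝ) ≤ v.adicAbv hb x := by
  have hval : v.valuation K x ≠ 0 :=
    (Valuation.ne_zero_iff _).mpr ((v.adicAbv hb).pos_iff.mp (zero_lt_one.trans hx))
  change (1 : ℝ) < WithZeroMulInt.toNNReal (ne_zero_of_lt hb) (v.valuation K x) at hx
  change (b : ℝ) ≤ WithZeroMulInt.toNNReal (ne_zero_of_lt hb) (v.valuation K x)
  rw [WithZeroMulInt.toNNReal_neg_apply _ hval] at hx ⊢
  norm_cast at hx ⊢
  simpa using zpow_le_zpow_right₀ hb.le (Int.add_one_le_iff.mpr ((one_lt_zpow_iff_right₀ hb).mp hx))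

section IntegralPolynomial

variable {R : Type*} [CommRing R] [Nontrivial R] {w : AbsoluteValue R ℝ} {g : R[X]}

theorem apply_eval_le_one (hw : IsNonarchimedean w) (hg : ∀ i, w (g.coeff i) ≤ 1) {z : R}
    (hz : w z ≤ 1) : w (g.eval z) ≤ 1 := by
  rw [eval_eq_sum_range]
  obtain ⟨i, -, hi⟩ := hw.finset_image_add_of_nonempty (fun i => g.coeff i * z ^ i)
    (Finset.nonempty_range_add_one (n := g.natDegree))
  refine hi.trans ?_
  rw [map_mul, map_pow]
  exact mul_le_one₀ (hg i) (by positivity) (pow_le_one₀ (by positivity) hz)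

theorem apply_eval_eq_pow_natDegree (hw : IsNonarchimedean w) (hg : ∀ i, w (g.coeff i) ≤ 1)
    (hm : g.Monic) {z : R} (hz : 1 < w z) : w (g.eval z) = w z ^ g.natDegree := by
  have hlower : ∀ j ∈ Finset.range (g.natDegree + 1), j ≠ g.natDegree →
      w (g.coeff j * z ^ j) < w (g.coeff g.natDegree * z ^ g.natDegree) := fun j hj hne => by
    have hlt : j < g.natDegree := by grind
    simp only [map_mul, map_pow, hm.coeff_natDegree, one_mul]
    calc w (g.coeff j) * w z ^ j ≤ w z ^ j := mul_le_of_le_one_left (by positivity) (hg j)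
      _ < w z ^ g.natDegree := pow_lt_pow_right₀ hz hlt
  rw [eval_eq_sum_range, hw.apply_sum_eq_of_lt (fun a => (w.map_neg a).symm)
    (Finset.self_mem_range_succ _) hlower, hm.coeff_natDegree, one_mul, map_pow]

theorem one_lt_apply_of_notMem_filledJuliaSet {L : Type*} [Field L] {w : AbsoluteValue L ℝ}
    {g : L[X]} (hw : IsNonarchimedean w) (hg : ∀ i, w (g.coeff i) ≤ 1) {z : L}
    (hz : z ∉ filledJuliaSet w g) : 1 < w z := by
  by_contra! hz1
  refine hz ⟨1, fun N => ?_⟩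
  induction N with
  | zero => exact hz1
  | succ N ih =>
    rw [Function.iterate_succ_apply']
    exact apply_eval_le_one hw hg ih

end IntegralPolynomial

/-- A backward orbit of the polynomial `g`: a sequence in which each term is the value of `g` at the
next one, as for the points `P n` of the theorem. -/
def IsBackwardOrbit {R : Type*} [CommRing R] (g : R[X]) (P : ℕ → R) : Prop :=
  ∀ n, g.eval (P (n + 1)) = P n

namespace IsBackwardOrbit

section Ring

variable {R : Type*} [CommRing R] [Nontrivial R] {w : AbsoluteValue R ℝ} {g : R[X]} {P : ℕ → R}

theorem one_lt_apply (hP : IsBackwardOrbit g P) (hw : IsNonarchimedean w)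
    (hg : ∀ i, w (g.coeff i) ≤ 1) (hP0 : 1 < w (P 0)) (n : ℕ) : 1 < w (P n) := by
  induction n with
  | zero => exact hP0
  | succ n ih =>
    by_contra! hle
    exact (hP n ▸ apply_eval_le_one hw hg hle).not_gt ih

theorem apply_pow_natDegree_pow (hP : IsBackwardOrbit g P) (hw : IsNonarchimedean w)
    (hg : ∀ i, w (g.coeff i) ≤ 1) (hm : g.Monic) (hP0 : 1 < w (P 0)) (n : ℕ) :
    w (P n) ^ g.natDegree ^ n = w (P 0) := by
  induction n with
  | zero => rw [pow_zero, pow_one]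
  | succ n ih =>
    rw [pow_succ', pow_mul,
      ← apply_eval_eq_pow_natDegree hw hg hm (hP.one_lt_apply hw hg hP0 (n + 1)), hP n, ih]

theorem natDegree_pos (hP : IsBackwardOrbit g P) (hm : g.Monic) (hP0 : 1 < w (P 0)) :
    0 < g.natDegree := by
  by_contra! hd
  have hP0_eq : P 0 = 1 := by
    rw [← hP 0, hm.natDegree_eq_zero.mp (Nat.le_zero.mp hd), eval_one]
  exact hP0.ne' (hP0_eq ▸ map_one w)

end Ring

theorem exists_natDegree_pow_le_mul_finrank {K L : Type*} [Field K] [Field L] [Algebra K L]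
    [Algebra.IsIntegral K L] {w : AbsoluteValue L ℝ} {g : L[X]} {P : ℕ → L}
    (hP : IsBackwardOrbit g P) (hw : IsNonarchimedean w) {q : ℝ} (hq1 : 1 < q)
    (hq : ∀ c : K, 1 < w (algebraMap K L c) → q ≤ w (algebraMap K L c))
    (hg : ∀ i, w (g.coeff i) ≤ 1) (hm : g.Monic) (hP0 : 1 < w (P 0)) :
    ∃ m, ∀ n, g.natDegree ^ n ≤ m * Module.finrank K K⟮P n⟯ := by
  obtain ⟨m, hqm⟩ := pow_unbounded_of_one_lt (w (P 0)) hq1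
  refine ⟨m, fun n => (pow_le_pow_iff_right₀ hq1).mp ?_⟩
  have hqP : q ≤ w (P n) ^ Module.finrank K K⟮P n⟯ :=
    le_apply_pow_finrank_adjoin_simple hw hq (Algebra.IsIntegral.isIntegral _)
      (hP.one_lt_apply hw hg hP0 n)
  calc q ^ g.natDegree ^ n
      ≤ (w (P n) ^ Module.finrank K K⟮P n⟯) ^ g.natDegree ^ n := by gcongr
    _ = w (P 0) ^ Module.finrank K K⟮P n⟯ := by
      rw [pow_right_comm, hP.apply_pow_natDegree_pow hw hg hm hP0]
    _ ≤ (q ^ m) ^ Module.finrank K K⟮P n⟯ := by gcongr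
    _ = q ^ (m * Module.finrank K K⟮P n⟯) := (pow_mul ..).symm

end IsBackwardOrbit

section AdjoinSimple

variable {K L : Type*} [Field K] [Field L] [Algebra K L]

theorem adjoin_simple_aeval_le (f : K[X]) (y : L) : K⟮aeval y f⟯ ≤ K⟮y⟯ :=
  IntermediateField.adjoin_simple_le_iff.mpr
    (IntermediateField.algebra_adjoin_le_adjoin K _ (aeval_mem_adjoin_singleton K y))

theorem relfinrank_adjoin_simple_aeval_le_natDegree {f : K[X]} (hd : 0 < f.natDegree) (y : L) :
    IntermediateField.relfinrank K⟮aeval y f⟯ K⟮y⟯ ≤ f.natDegree := by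
  set F := K⟮aeval y f⟯
  set g : F[X] := f.map (algebraMap K F) - C (IntermediateField.AdjoinSimple.gen K (aeval y f))
  have hgdeg : g.natDegree = f.natDegree := by rw [natDegree_sub_C, natDegree_map]
  have hg0 : g ≠ 0 := ne_zero_of_natDegree_gt (hgdeg ▸ hd)
  have hroot : aeval y g = 0 := by simp [g, F]
  have hint : IsIntegral F y := IsAlgebraic.isIntegral ⟨g, hg0, hroot⟩
  rw [IntermediateField.relfinrank_eq_finrank_of_le (adjoin_simple_aeval_le f y),
    IntermediateField.extendScalars_adjoin, IntermediateField.adjoin.finrank hint, ← hgdeg]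
  exact natDegree_le_of_dvd (minpoly.dvd F y hroot) hg0

end AdjoinSimple

section Growth

open Filter Topology

theorem tendsto_succ_div_of_antitone {a : ℕ → ℝ} (ha : Antitone a) {c : ℝ} (hc : 0 < c)
    (hca : ∀ n, c ≤ a n) : Tendsto (fun n => a (n + 1) / a n) atTop (𝓝 1) := by
  have hlim : Tendsto a atTop (𝓝 (⨅ n, a n)) :=
    tendsto_atTop_ciInf ha ⟨c, Set.forall_mem_range.mpr hca⟩
  have hpos : 0 < ⨅ n, a n := hc.trans_le (le_ciInf hca)
  rw [← div_self hpos.ne']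
  exact ((tendsto_add_atTop_iff_nat 1).mpr hlim).div hlim hpos.ne'

theorem eventually_eq_of_pow_le_mul {N r : ℕ → ℕ} {d m : ℕ} (hd : 0 < d)
    (hN : ∀ n, N n * r n = N (n + 1)) (hr : ∀ n, r n ≤ d) (hle : ∀ n, d ^ n ≤ m * N n) :
    ∀ᶠ n in atTop, r n = d := by
  have hd' : (0 : ℝ) < d := mod_cast hd
  have hm : (0 : ℝ) < m := mod_cast Nat.pos_of_mul_pos_right ((pow_pos hd 0).trans_le (hle 0))
  set a : ℕ → ℝ := fun n => N n / d ^ n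
  have hbound (n : ℕ) : (m : ℝ)⁻¹ ≤ a n := by
    rw [le_div_iff₀ (by positivity), inv_mul_le_iff₀ hm]
    exact_mod_cast hle n
  have hpos (n : ℕ) : 0 < a n := (inv_pos.mpr hm).trans_le (hbound n)
  have hstep (n : ℕ) : a (n + 1) = a n * (r n / d) := by
    simp only [a, ← hN, Nat.cast_mul, pow_succ, mul_div_mul_comm]
  have hanti : Antitone a := antitone_nat_of_succ_le fun n => by
    rw [hstep]
    exact mul_le_of_le_one_right (hpos n).le ((div_le_one hd').mpr (mod_cast hr n))
  have hratio : Tendsto (fun n => (r n / d : ℝ)) atTop (𝓝 1) := by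
    simpa only [hstep, mul_div_cancel_left₀ _ (hpos _).ne'] using
      tendsto_succ_div_of_antitone hanti (inv_pos.mpr hm) hbound
  have hcast : Tendsto (fun n => (r n : ℝ)) atTop (𝓝 (d : ℝ)) := by
    simpa only [div_mul_cancel₀ _ hd'.ne', one_mul] using hratio.mul_const (d : ℝ)
  have hlim : Tendsto r atTop (𝓝 d) :=
    Nat.isClosedEmbedding_coe_real.isInducing.tendsto_nhds_iff.mpr hcast
  rwa [nhds_discrete, tendsto_pure] at hlim

end Growth

theorem corollary3_general {K L : Type*} [Field K] [Field L] [Algebra K L]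
    [Algebra.IsIntegral K L] (f : K[X]) (hf : f.Monic) (P : ℕ → L)
    (hP : ∀ n : ℕ, aeval (P (n + 1)) f = P n) {v : AbsoluteValue K ℝ} (hv : IsNonarchimedean v)
    {q : ℝ} (hq1 : 1 < q) (hq : ∀ c : K, 1 < v c → q ≤ v c) (hgood : ∀ i, v (f.coeff i) ≤ 1)
    (w : AbsoluteValue L ℝ) (hw : w.LiesOver v)
    (hP0 : P 0 ∉ filledJuliaSet w (f.map (algebraMap K L))) :
    ∀ᶠ n : ℕ in Filter.atTop,
      K⟮P n⟯ ≤ K⟮P (n + 1)⟯ ∧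
        IntermediateField.relfinrank K⟮P n⟯ K⟮P (n + 1)⟯ = f.natDegree := by
  have hwK := apply_algebraMap_of_liesOver hw
  have hna : IsNonarchimedean w := isNonarchimedean_of_liesOver hv hw
  have hg (i : ℕ) : w ((f.map (algebraMap K L)).coeff i) ≤ 1 := by
    rw [coeff_map, hwK]
    exact hgood i
  have horbit : IsBackwardOrbit (f.map (algebraMap K L)) P := fun n => by
    rw [eval_map_algebraMap, hP]
  have hP1 : 1 < w (P 0) := one_lt_apply_of_notMem_filledJuliaSet hna hg hP0
  obtain ⟨m, hm⟩ := horbit.exists_natDegree_pow_le_mul_finrank hna hq1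
    (fun c => by rw [hwK]; exact hq c) hg (hf.map _) hP1
  have hd : 0 < f.natDegree := by simpa using horbit.natDegree_pos (hf.map _) hP1
  have hle (n : ℕ) : K⟮P n⟯ ≤ K⟮P (n + 1)⟯ := by
    simpa only [hP] using adjoin_simple_aeval_le f (P (n + 1))
  have hrel (n : ℕ) : IntermediateField.relfinrank K⟮P n⟯ K⟮P (n + 1)⟯ ≤ f.natDegree := by
    simpa only [hP] using relfinrank_adjoin_simple_aeval_le_natDegree hd (P (n + 1))
  have heq := eventually_eq_of_pow_le_mul hd
    (fun n => IntermediateField.finrank_bot_mul_relfinrank (hle n)) hrel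
    (by simpa only [natDegree_map] using hm)
  exact heq.mono fun n hn => ⟨hle n, hn⟩

theorem corollary3 {K : Type*} [Field K] [NumberField K] (f : K[X]) (hf : f.Monic)
    (P : ℕ → AlgebraicClosure K)
    (hP : ∀ n : ℕ, aeval (P (n + 1)) f = P n)
    (v : IsDedekindDomain.HeightOneSpectrum (𝓞 K))
    (p : ℕ) (hp : p.Prime) (hpv : (p : 𝓞 K) ∈ v.asIdeal)
    (hpd : ¬ p ∣ f.natDegree)
    (hgood : MonicHasGoodReduction v f)
    (w : AbsoluteValue (AlgebraicClosure K) ℝ)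
    (hw : w.LiesOver (NumberField.HeightOneSpectrum.adicAbv K v))
    (hP0 : P 0 ∉ filledJuliaSet w (f.map (algebraMap K (AlgebraicClosure K)))) :
    ∀ᶠ n : ℕ in Filter.atTop,
      K⟮P n⟯ ≤ K⟮P (n + 1)⟯ ∧
        IntermediateField.relfinrank K⟮P n⟯ K⟮P (n + 1)⟯ = f.natDegree :=
  corollary3_general f hf P hP (NumberField.HeightOneSpectrum.isNonarchimedean_adicAbv K v)
    (mod_cast NumberField.HeightOneSpectrum.one_lt_absNorm_nnreal v)
    (fun _ => le_adicAbv_of_one_lt v _) hgood w hw hP0
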